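/- Let $D$ be a finite digraph without loops and without parallel arcs (two opposite arcs between the same two vertices, i.e. a digon, are allowed). Let $d^+(v)$ and $d^-(v)$ denote the out-degree and the in-degree of a vertex $v$, and let $\Delta_{\min}(D)=\max_{v\in V(D)}\min\{d^+(v),d^-(v)\}$. Let $\vec\chi(D)$ be the dichromatic number of $D$, that is, the smallest $k$ such that $V(D)$ has a colouring with $k$ colours in which every colour class induces a subdigraph without directed cycles (a digon being a directed cycle of length $2$). If $\vec\chi(D)=\Delta_{\min}(D)+1$, then $D$ contains, as a subdigraph, the complete bidirected graph on $\left\lceil\frac{\Delta_{\min}(D)+1}{2}\right\rceil$ vertices, that is, the digraph on that many vertices in which every two distinct vertices are joined by arcs in both directions. -/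

import Mathlib

namespace Digraph

/-- The out-degree of `v`: the number of arcs leaving `v`. -/
noncomputable def outDeg {V : Type*} (D : Digraph V) (v : V) : ℕ :=
  {w : V | D.Adj v w}.ncard

/-- The in-degree of `v`: the number of arcs entering `v`. -/
noncomputable def inDeg {V : Type*} (D : Digraph V) (v : V) : ℕ :=
  {w : V | D.Adj w v}.ncard

/-- The minimum degree of the vertex `v`: the smaller of its out-degree and its in-degree. -/
noncomputable def vertexMinDeg {V : Type*} (D : Digraph V) (v : V) : ℕ :=
  min (D.outDeg v) (D.inDeg v)

/-- `Δ_min(D)`: the maximum over all vertices `v` of `min (d⁺(v), d⁻(v))`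
(with the value `0` if there are no vertices). -/
noncomputable def deltaMin {V : Type*} [Fintype V] (D : Digraph V) : ℕ :=
  Finset.univ.sup D.vertexMinDeg

/-- `D` has a directed cycle of length `n + 1`: distinct vertices `v 0, …, v n` with an arc from
each `v i` to `v (i + 1)`, where `i + 1` is taken cyclically, so there is an arc from `v n`
to `v 0`. (A digon is a cycle of length two.) -/
def HasCycleOfLengthSucc {V : Type*} (D : Digraph V) (n : ℕ) : Prop :=
  ∃ v : Fin (n + 1) → V, Function.Injective v ∧ ∀ i, D.Adj (v i) (v (i + 1))

/-- A digraph is acyclic if it has no directed cycle. -/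
def IsAcyclic {V : Type*} (D : Digraph V) : Prop :=
  ∀ n : ℕ, ¬ D.HasCycleOfLengthSucc n

/-- The subdigraph of `D` induced by the vertex set `s`. -/
def induce {V : Type*} (D : Digraph V) (s : Set V) : Digraph s where
  Adj a b := D.Adj a b

/-- `c` is a `k`-dicolouring of `D`: every colour class induces an acyclic subdigraph. -/
def IsDicolouring {V : Type*} (D : Digraph V) {k : ℕ} (c : V → Fin k) : Prop :=
  ∀ i : Fin k, (D.induce (c ⁻¹' {i})).IsAcyclic

/-- The dichromatic number of `D`: the least `k` such that `D` has a `k`-dicolouring. Such a `k`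
exists for every finite digraph without loops, since one may give all vertices distinct colours. -/
noncomputable def dichromaticNumber {V : Type*} (D : Digraph V) : ℕ :=
  sInf {k : ℕ | ∃ c : V → Fin k, D.IsDicolouring c}

/-- The bidirected graph associated to the graph `G`: every edge is replaced by a digon. -/
def bidirected {V : Type*} (G : SimpleGraph V) : Digraph V where
  Adj := G.Adj

/-- `D` contains (a copy of) `H` as a subdigraph, not necessarily induced. -/
def ContainsSubdigraph {V W : Type*} (D : Digraph V) (H : Digraph W) : Prop :=
  ∃ f : W → V, Function.Injective f ∧ ∀ a b : W, H.Adj a b → D.Adj (f a) (f b)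

end Digraph

/-!
The theorem is a consequence of Brooks' theorem for digraphs, applied to a modification of `D` that
becomes regular. Write `k = Δ_min(D)` and let `X` be the set of vertices of out-degree at most `k`,
so that the vertices off `X` have in-degree at most `k`. In `D.doubleCut X` the arcs leaving `X` are
made digons and the arcs entering `X` are deleted. This does not change the out-degrees in `X` and
the in-degrees off `X`, and every dicolouring of the new digraph is one of `D`
(`DicolouringOn.of_doubleCut`), so the new digraph is not `k`-dicolourable. Take a minimal set `W`
of vertices on which it is not. All degrees in `W` are at least `k`; as only digons join `X` to its
complement, counting arcs shows that in `W` all in- and out-degrees equal `k`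
(`IsCritical.isCriticalRegular`). By Brooks' theorem (`IsCriticalRegular.exists_clique_or`), `W`
carries a bidirected clique on `k + 1` vertices or, if `k = 2`, possibly only digons. A bidirected
clique meets one of `X` and its complement in at least half of its vertices, and there it is a
bidirected clique of `D`. In the exceptional case some digon lies on one side of the partition, as
otherwise the two sides would be the classes of a `2`-dicolouring.

The proof of Brooks' theorem rests on dicolourings that leave a single vertex `v` uncoloured. By
regularity, each of the `k` colours occurs exactly once among the out-neighbours of `v` and exactly
once among its in-neighbours. Hence `v` may take over the colour of any neighbour, which then becomes
the uncoloured vertex. Pushing the uncoloured vertex around a cycle of the underlying graph moves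
the colours on that cycle (`IsPeriodicCycle.exists_dicolouringOn`), and this shows that a cycle on
which some vertex has all its neighbours must be spanning (`IsCriticalRegular.range_eq_univ`).
So paths extend to Hamiltonian paths. If two out-neighbours `y`, `z` of `x` do not form a digon, a
Hamiltonian path that begins with `y`, `x`, `z` guides a greedy colouring in which `y` and `z` have
the same colour and only `x` is uncoloured, which is impossible, unless `x` has no neighbour
besides `y` and `z` (`IsCriticalRegular.eq_or_eq_of_touches`).
-/

namespace Digraph

/-! ### Acyclic vertex sets and partial dicolourings -/

/-- The set `S` induces an acyclic subdigraph, expressed without cycles: every nonempty subset of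
`S` contains a sink of the subdigraph which that subset induces. For finite `S` this is equivalent
to the absence of directed cycles. -/
def AcyclicOn {V : Type*} (D : Digraph V) (S : Set V) : Prop :=
  ∀ T ⊆ S, T.Nonempty → ∃ v ∈ T, ∀ w ∈ T, ¬ D.Adj v w

/-- The restriction of `c` to `S` is a dicolouring of the subdigraph induced by `S`; the colours
outside `S` are irrelevant. -/
def DicolouringOn {V : Type*} (D : Digraph V) {k : ℕ} (c : V → Fin k) (S : Set V) : Prop :=
  ∀ i, D.AcyclicOn (S ∩ c ⁻¹' {i})

/-- Adjacency in the underlying undirected graph. -/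
def Touches {V : Type*} (D : Digraph V) (u v : V) : Prop :=
  D.Adj u v ∨ D.Adj v u

theorem Touches.symm {V : Type*} {D : Digraph V} {u v : V} (h : D.Touches u v) :
    D.Touches v u :=
  Or.symm h

/-- The pair `u`, `v` is joined by arcs in both directions. -/
def IsDigon {V : Type*} (D : Digraph V) (u v : V) : Prop :=
  D.Adj u v ∧ D.Adj v u

theorem IsDigon.symm {V : Type*} {D : Digraph V} {u v : V} (h : D.IsDigon u v) :
    D.IsDigon v u :=
  And.symm h

/-- The arcs at a vertex in the direction `b`: `D.dirAdj true v u` says that `u` is an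
out-neighbour of `v`, and `D.dirAdj false v u` that `u` is an in-neighbour of `v`. -/
def dirAdj {V : Type*} (D : Digraph V) (b : Bool) (v u : V) : Prop :=
  match b with
  | true => D.Adj v u
  | false => D.Adj u v

theorem touches_iff_exists_dirAdj {V : Type*} {D : Digraph V} {u v : V} :
    D.Touches u v ↔ ∃ b, D.dirAdj b u v := by
  simp [Touches, dirAdj, or_comm]

section Acyclic

variable {V : Type*} {D : Digraph V} {S T : Set V}

theorem AcyclicOn.mono (hT : D.AcyclicOn T) (h : S ⊆ T) : D.AcyclicOn S :=
  fun U hU hne => hT U (hU.trans h) hne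

theorem acyclicOn_of_forall_not_adj (h : ∀ u ∈ S, ∀ v ∈ S, ¬ D.Adj u v) : D.AcyclicOn S :=
  fun _ hU ⟨v, hv⟩ => ⟨v, hv, fun w hw => h v (hU hv) w (hU hw)⟩

theorem AcyclicOn.union (hS : D.AcyclicOn S) (hT : D.AcyclicOn T)
    (h : ∀ s ∈ S, ∀ t ∈ T, ¬ D.Adj s t) : D.AcyclicOn (S ∪ T) := by
  intro U hU hne
  by_cases hUS : (U ∩ S).Nonempty
  · obtain ⟨v, hv, hsink⟩ := hS (U ∩ S) Set.inter_subset_right hUS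
    refine ⟨v, hv.1, fun w hw => ?_⟩
    rcases hU hw with hwS | hwT
    · exact hsink w ⟨hw, hwS⟩
    · exact h v hv.2 w hwT
  · refine hT U (fun w hw => (hU hw).resolve_left fun hwS => hUS ⟨w, hw, hwS⟩) hne

theorem AcyclicOn.not_isDigon {u v : V} (hS : D.AcyclicOn S) (hu : u ∈ S) (hv : v ∈ S) :
    ¬ D.IsDigon u v := by
  rintro ⟨huv, hvu⟩
  obtain ⟨w, hw, hsink⟩ := hS {u, v} (by rintro w (rfl | rfl) <;> assumption) ⟨u, by simp⟩
  rcases hw with rfl | rfl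
  · exact hsink v (by simp) huv
  · exact hsink u (by simp) hvu

theorem isDicolouring_of_dicolouringOn {k : ℕ} {c : V → Fin k}
    (h : D.DicolouringOn c Set.univ) : D.IsDicolouring c := by
  rintro i n ⟨v, -, hv⟩
  obtain ⟨_, ⟨j, rfl⟩, hsink⟩ := h i (Set.range fun j => (v j : V))
    (by rintro _ ⟨j, rfl⟩; exact ⟨trivial, (v j).2⟩) ⟨_, 0, rfl⟩
  exact hsink _ ⟨j + 1, rfl⟩ (hv j)

theorem DicolouringOn.mono {k : ℕ} {c : V → Fin k} (h : D.DicolouringOn c T) (hST : S ⊆ T) :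
    D.DicolouringOn c S :=
  fun i => (h i).mono (Set.inter_subset_inter_left _ hST)

theorem DicolouringOn.congr {k : ℕ} {c c' : V → Fin k} (h : D.DicolouringOn c S)
    (hc : ∀ v ∈ S, c' v = c v) : D.DicolouringOn c' S :=
  fun i => (h i).mono fun v hv => ⟨hv.1, by rw [Set.mem_preimage, ← hc v hv.1]; exact hv.2⟩

/-- A vertex may receive the colour `i` as soon as no out-neighbour, or no in-neighbour, of it
has that colour. -/
theorem DicolouringOn.update [DecidableEq V] (hloop : ∀ v, ¬ D.Adj v v) {k : ℕ} {c : V → Fin k}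
    (h : D.DicolouringOn c S) {v : V} (hv : v ∉ S) (i : Fin k) (b : Bool)
    (hi : ∀ u ∈ S, c u = i → ¬ D.dirAdj b v u) :
    D.DicolouringOn (Function.update c v i) (insert v S) := by
  have hne : ∀ u ∈ S, u ≠ v := fun u hu huv => hv (huv ▸ hu)
  intro j
  by_cases hj : j = i
  · subst hj
    have hsub : insert v S ∩ Function.update c v j ⁻¹' {j} ⊆ {v} ∪ (S ∩ c ⁻¹' {j}) := by
      rintro u ⟨rfl | hu, huj⟩
      · exact Or.inl rfl
      · refine Or.inr ⟨hu, ?_⟩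
        simpa [Function.update_of_ne (hne u hu)] using huj
    have hsingle : D.AcyclicOn {v} :=
      acyclicOn_of_forall_not_adj (by rintro _ rfl _ rfl; exact hloop _)
    cases b with
    | true =>
      refine (hsingle.union (h j) ?_).mono hsub
      rintro _ rfl u ⟨hu, huj⟩
      exact hi u hu huj
    | false =>
      rw [Set.union_comm] at hsub
      refine ((h j).union hsingle ?_).mono hsub
      rintro u ⟨hu, huj⟩ _ rfl
      exact hi u hu huj
  · refine (h j).mono ?_
    rintro u ⟨rfl | hu, huj⟩
    · simp only [Set.mem_preimage, Function.update_self, Set.mem_singleton_iff] at huj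
      exact absurd huj.symm hj
    · refine ⟨hu, ?_⟩
      simpa [Function.update_of_ne (hne u hu)] using huj

end Acyclic

/-! ### Moving the uncoloured vertex of a critical regular digraph -/

/-- A loopless digraph that is not `k`-dicolourable but all of whose proper induced subdigraphs
are. -/
structure IsCritical {V : Type*} (D : Digraph V) (k : ℕ) : Prop where
  loopless : ∀ v, ¬ D.Adj v v
  not_dicolouringOn : ∀ c : V → Fin k, ¬ D.DicolouringOn c Set.univ
  exists_dicolouringOn : ∀ S : Set V, S ≠ Set.univ → ∃ c : V → Fin k, D.DicolouringOn c S

/-- A critical digraph in which all out-degrees and all in-degrees equal `k`. -/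
structure IsCriticalRegular {V : Type*} (D : Digraph V) (k : ℕ) : Prop extends IsCritical D k where
  outDeg_eq : ∀ v, D.outDeg v = k
  inDeg_eq : ∀ v, D.inDeg v = k

namespace IsCritical

variable {V : Type*} {D : Digraph V} {k : ℕ}

/-- If only `v` is uncoloured, every colour occurs among the out-neighbours of `v`, and among its
in-neighbours: otherwise the colouring could be completed. -/
theorem exists_dirAdj_colour_eq (hD : D.IsCritical k) {c : V → Fin k} {v : V}
    (hc : D.DicolouringOn c {v}ᶜ) (b : Bool) (i : Fin k) : ∃ u, D.dirAdj b v u ∧ c u = i := by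
  classical
  by_contra! hno
  refine hD.not_dicolouringOn (Function.update c v i) ?_
  have := hc.update hD.loopless (v := v) (by simp) i b fun u _ hu hvu => hno u hvu hu
  refine this.mono fun u _ => ?_
  by_cases huv : u = v
  · exact Or.inl huv
  · exact Or.inr huv

theorem le_ncard_dirAdj [Finite V] (hD : D.IsCritical k) (b : Bool) (v : V) :
    k ≤ {u | D.dirAdj b v u}.ncard := by
  obtain ⟨c, hc⟩ := hD.exists_dicolouringOn {v}ᶜ (by simp)
  have himage : c '' {u | D.dirAdj b v u} = Set.univ :=
    Set.eq_univ_of_forall fun i => hD.exists_dirAdj_colour_eq hc b i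
  have hle := Set.ncard_image_le (f := c) (Set.toFinite {u | D.dirAdj b v u})
  rwa [himage, Set.ncard_univ, Nat.card_eq_fintype_card, Fintype.card_fin] at hle

end IsCritical

namespace IsCriticalRegular

variable {V : Type*} {D : Digraph V} {k : ℕ}

theorem ncard_dirAdj (hD : D.IsCriticalRegular k) (b : Bool) (v : V) :
    {u | D.dirAdj b v u}.ncard = k := by
  cases b with
  | true => exact hD.outDeg_eq v
  | false => exact hD.inDeg_eq v

theorem dirAdj_irrefl (hD : D.IsCriticalRegular k) (b : Bool) (v : V) : ¬ D.dirAdj b v v := by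
  cases b <;> exact hD.loopless v

theorem ne_of_touches (hD : D.IsCriticalRegular k) {u v : V} (h : D.Touches u v) : u ≠ v := by
  rintro rfl
  exact h.elim (hD.loopless u) (hD.loopless u)

/-- If only `v` is uncoloured, no colour is repeated among its `k` out-neighbours, nor among its
`k` in-neighbours. -/
theorem injOn_dirAdj [Finite V] (hD : D.IsCriticalRegular k) {c : V → Fin k} {v : V}
    (hc : D.DicolouringOn c {v}ᶜ) (b : Bool) : Set.InjOn c {u | D.dirAdj b v u} := by
  refine Set.injOn_of_ncard_image_eq ?_ (Set.toFinite _)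
  have : c '' {u | D.dirAdj b v u} = Set.univ :=
    Set.eq_univ_of_forall fun i => hD.exists_dirAdj_colour_eq hc b i
  rw [this, hD.ncard_dirAdj, Set.ncard_univ, Nat.card_eq_fintype_card, Fintype.card_fin]

/-- The uncoloured vertex `v` may exchange its role with any neighbour `u`: `v` takes over the
colour of `u`. -/
theorem dicolouringOn_swap [DecidableEq V] [Finite V] (hD : D.IsCriticalRegular k)
    {c : V → Fin k} {v u : V} (hc : D.DicolouringOn c {v}ᶜ) (huv : D.Touches v u) :
    D.DicolouringOn (c ∘ Equiv.swap v u) {u}ᶜ := by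
  have hne := hD.ne_of_touches huv
  obtain ⟨b, hb⟩ := touches_iff_exists_dirAdj.1 huv
  have h := (hc.mono (S := {v, u}ᶜ) (by intro w hw; simp_all)).update hD.loopless
    (v := v) (by simp) (c u) b fun w hw hwu hvw =>
      hw (Or.inr (hD.injOn_dirAdj hc b hvw hb hwu))
  refine (h.mono fun w hw => ?_).congr fun w hw => ?_
  · by_cases hwv : w = v
    · exact Or.inl hwv
    · exact Or.inr (by simp_all)
  · by_cases hwv : w = v
    · subst hwv; simp
    · rw [Function.update_of_ne hwv, Function.comp, Equiv.swap_apply_of_ne_of_ne hwv hw]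

end IsCriticalRegular

/-- A cycle of length `m` of the underlying undirected graph, traversed periodically by `f`. The
degenerate case `m = 2` of an edge traversed back and forth is included. -/
structure IsPeriodicCycle {V : Type*} (D : Digraph V) (f : ℕ → V) (m : ℕ) : Prop where
  pos : 0 < m
  eq_iff : ∀ i j, f i = f j ↔ i ≡ j [MOD m]
  touches : ∀ i, D.Touches (f i) (f (i + 1))

theorem IsPeriodicCycle.exists_offset {V : Type*} {D : Digraph V} {f : ℕ → V} {m : ℕ}
    (hf : D.IsPeriodicCycle f m) {i j : ℕ} (h : f i ≠ f j) :
    ∃ e, 1 ≤ e ∧ e < m ∧ f (i + e) = f j := by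
  have hpos := hf.pos
  have hmod : i + (j + (m - 1) * i) % m ≡ j [MOD m] := by
    have h1 : i + (j + (m - 1) * i) % m ≡ i + (j + (m - 1) * i) [MOD m] :=
      (Nat.mod_modEq _ _).add_left i
    refine h1.trans ?_
    have : i + (j + (m - 1) * i) = j + m * i := by
      obtain ⟨r, rfl⟩ : ∃ r, m = r + 1 := ⟨m - 1, by omega⟩
      simp only [Nat.add_sub_cancel]
      ring
    rw [this]
    simp [Nat.ModEq]
  refine ⟨(j + (m - 1) * i) % m, ?_, Nat.mod_lt _ hpos, (hf.eq_iff _ _).2 hmod⟩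
  by_contra h0
  have h0 : (j + (m - 1) * i) % m = 0 := by omega
  rw [h0] at hmod
  exact h ((hf.eq_iff _ _).2 hmod)

/-- Some dicolouring leaves exactly `f i` uncoloured, gives the colour `a` to the vertex that
lies `d` steps further along `f`, and agrees with `c₀` off `f`. -/
def HasShift {V : Type*} (D : Digraph V) {k : ℕ} (f : ℕ → V) (c₀ : V → Fin k) (a : Fin k)
    (i d : ℕ) : Prop :=
  ∃ c : V → Fin k, D.DicolouringOn c {f i}ᶜ ∧ c (f (i + d)) = a ∧ ∀ v ∉ Set.range f, c v = c₀ v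

section Cycle

variable {V : Type*} [Finite V] {D : Digraph V} {k m : ℕ} {f : ℕ → V} {c₀ : V → Fin k} {a : Fin k}

theorem HasShift.succ (hf : D.IsPeriodicCycle f m) (hD : D.IsCriticalRegular k) {i d : ℕ}
    (hd : d + 2 < m) (h : D.HasShift f c₀ a i (d + 2)) : D.HasShift f c₀ a (i + 1) (d + 1) := by
  classical
  obtain ⟨c, hc, ha, hoff⟩ := h
  refine ⟨_, hD.dicolouringOn_swap hc (hf.touches i), ?_, fun v hv => ?_⟩
  · have h1 : f (i + (d + 2)) ≠ f i := fun h => by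
      have := (hf.eq_iff _ (i + 0)).1 h
      have := Nat.ModEq.add_left_cancel' i this
      rw [Nat.ModEq, Nat.mod_eq_of_lt hd, Nat.zero_mod] at this
      omega
    have h2 : f (i + (d + 2)) ≠ f (i + 1) := fun h => by
      have := (hf.eq_iff _ _).1 h
      have := Nat.ModEq.add_left_cancel' i this
      rw [Nat.ModEq, Nat.mod_eq_of_lt hd, Nat.mod_eq_of_lt (by omega)] at this
      omega
    rw [show i + 1 + (d + 1) = i + (d + 2) by ring, Function.comp,
      Equiv.swap_apply_of_ne_of_ne h1 h2, ha]
  · rw [Function.comp, Equiv.swap_apply_of_ne_of_ne, hoff v hv]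
    · rintro rfl; exact hv ⟨_, rfl⟩
    · rintro rfl; exact hv ⟨_, rfl⟩

/-- The colour `a` stands right in front of the uncoloured vertex, so that it jumps behind it. -/
theorem HasShift.wrap (hf : D.IsPeriodicCycle f m) (hD : D.IsCriticalRegular k) {i : ℕ}
    (h : D.HasShift f c₀ a i 1) : D.HasShift f c₀ a (i + 1) (m - 1) := by
  classical
  obtain ⟨c, hc, ha, hoff⟩ := h
  refine ⟨_, hD.dicolouringOn_swap hc (hf.touches i), ?_, fun v hv => ?_⟩
  · have h1 : f (i + 1 + (m - 1)) = f i := by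
      have := hf.pos
      rw [hf.eq_iff, show i + 1 + (m - 1) = i + m by omega]
      simp
    rw [h1, Function.comp, Equiv.swap_apply_left, ha]
  · rw [Function.comp, Equiv.swap_apply_of_ne_of_ne, hoff v hv]
    · rintro rfl; exact hv ⟨_, rfl⟩
    · rintro rfl; exact hv ⟨_, rfl⟩

theorem HasShift.descend (hf : D.IsPeriodicCycle f m) (hD : D.IsCriticalRegular k) {d : ℕ}
    (hd : 1 ≤ d) (n : ℕ) : ∀ {i : ℕ}, d + n < m → D.HasShift f c₀ a i (d + n) →
      D.HasShift f c₀ a (i + n) d := by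
  induction n with
  | zero => exact fun _ h => h
  | succ n ih =>
    intro i hdn h
    obtain ⟨d, rfl⟩ : ∃ e, d = e + 1 := ⟨d - 1, by omega⟩
    rw [show d + 1 + (n + 1) = d + n + 2 by ring] at h
    have := ih (by omega) (show D.HasShift f c₀ a (i + 1) (d + 1 + n) by
      rw [show d + 1 + n = d + n + 1 by ring]
      exact h.succ hf hD (by omega))
    rwa [show i + (n + 1) = i + 1 + n by ring]

/-- After `m - 1` moves of the uncoloured vertex the distance to the colour `a` is restored,
whereas the uncoloured vertex has gone back by one position. -/
theorem HasShift.back (hf : D.IsPeriodicCycle f m) (hD : D.IsCriticalRegular k) {i d : ℕ}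
    (hd : 1 ≤ d) (hdm : d < m) (h : D.HasShift f c₀ a i d) :
    D.HasShift f c₀ a (i + (m - 1)) d := by
  obtain ⟨e, rfl⟩ : ∃ e, d = 1 + e := ⟨d - 1, by omega⟩
  have h1 := ((h.descend hf hD le_rfl e hdm).wrap hf hD)
  obtain ⟨n, hn⟩ : ∃ n, m - 1 = 1 + e + n := ⟨m - 1 - (1 + e), by omega⟩
  rw [hn] at h1 ⊢
  have h2 := h1.descend hf hD hd n (by omega)
  rwa [show i + (1 + e + n) = i + e + 1 + n by ring]

theorem HasShift.back_mul (hf : D.IsPeriodicCycle f m) (hD : D.IsCriticalRegular k) {i d : ℕ}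
    (hd : 1 ≤ d) (hdm : d < m) (h : D.HasShift f c₀ a i d) (n : ℕ) :
    D.HasShift f c₀ a (i + n * (m - 1)) d := by
  induction n with
  | zero => simpa using h
  | succ n ih =>
    rw [show i + (n + 1) * (m - 1) = i + n * (m - 1) + (m - 1) by ring]
    exact ih.back hf hD hd hdm

theorem HasShift.exists_of_lt (hf : D.IsPeriodicCycle f m) (hD : D.IsCriticalRegular k)
    {i d e : ℕ} (hd : 1 ≤ d) (hdm : d < m) (he : 1 ≤ e) (hem : e < m)
    (h : D.HasShift f c₀ a i d) : ∃ j, D.HasShift f c₀ a j e := by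
  obtain ⟨n, rfl⟩ : ∃ n, d = 1 + n := ⟨d - 1, by omega⟩
  have h1 := (h.descend hf hD le_rfl n hdm).wrap hf hD
  obtain ⟨r, hr⟩ : ∃ r, m - 1 = e + r := ⟨m - 1 - e, by omega⟩
  rw [hr] at h1
  exact ⟨_, h1.descend hf hD he r (by omega)⟩

/-- By moving the uncoloured vertex along a cycle, a colour used on the cycle can be brought to
any vertex `s` of the cycle while any other vertex `w` of the cycle becomes the uncoloured one.
Nothing changes off the cycle. -/
theorem IsPeriodicCycle.exists_dicolouringOn (hf : D.IsPeriodicCycle f m)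
    (hD : D.IsCriticalRegular k) {c : V → Fin k} {v t w s : V} (hv : v ∈ Set.range f)
    (ht : t ∈ Set.range f) (hw : w ∈ Set.range f) (hs : s ∈ Set.range f) (hvt : v ≠ t)
    (hws : w ≠ s) (hc : D.DicolouringOn c {v}ᶜ) :
    ∃ c' : V → Fin k, D.DicolouringOn c' {w}ᶜ ∧ c' s = c t ∧ ∀ u ∉ Set.range f, c' u = c u := by
  obtain ⟨i, rfl⟩ := hv
  obtain ⟨j, rfl⟩ := ht
  obtain ⟨p, rfl⟩ := hw
  obtain ⟨q, rfl⟩ := hs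
  obtain ⟨d, hd, hdm, hdj⟩ := hf.exists_offset hvt
  obtain ⟨e, he, hem, heq⟩ := hf.exists_offset hws
  have h0 : D.HasShift f c (c (f j)) i d := ⟨c, hc, by rw [hdj], fun _ _ => rfl⟩
  obtain ⟨r, hr⟩ := h0.exists_of_lt hf hD hd hdm he hem
  -- Going back `n` times means adding `n * (m - 1) ≡ -n`; this `n` leads from `r` to `p`.
  have hmod : r + (r + (m - 1) * p) * (m - 1) ≡ p [MOD m] := by
    have hpos := hf.pos
    obtain ⟨l, rfl⟩ : ∃ l, m = l + 1 := ⟨m - 1, by omega⟩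
    rw [Nat.add_sub_cancel]
    have h2 : (r + (r + l * p) * l) + 2 * (l + 1) * p = p + (l + 1) * (r + (l + 1) * p) := by ring
    have h3 : (r + (r + l * p) * l) + 2 * (l + 1) * p ≡ r + (r + l * p) * l [MOD l + 1] := by
      rw [show 2 * (l + 1) * p = (l + 1) * (2 * p) by ring]
      simp [Nat.ModEq]
    refine h3.symm.trans ?_
    rw [h2]
    simp [Nat.ModEq]
  obtain ⟨c', hc', ha, hoff⟩ := hr.back_mul hf hD he hem (r + (m - 1) * p)
  rw [(hf.eq_iff _ _).2 hmod] at hc'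
  rw [(hf.eq_iff _ _).2 (hmod.add_right e), heq] at ha
  exact ⟨c', hc', ha, hoff⟩

end Cycle

/-! ### Cycles and paths in a critical regular digraph -/

namespace IsCriticalRegular

variable {V : Type*} [Finite V] {D : Digraph V} {k : ℕ}

/-- Suppose some vertex `q` of a cycle has all its neighbours on the cycle. Then no vertex `p` of
the cycle has two out-neighbours (or two in-neighbours) of which exactly one lies on the cycle:
the colour of the outer one is also used on the cycle, as it occurs around `q` when `q` is
uncoloured, so it can be brought to the inner one, with `p` uncoloured. -/
theorem mem_range_of_dirAdj (hD : D.IsCriticalRegular k) {f : ℕ → V} {m : ℕ}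
    (hf : D.IsPeriodicCycle f m) {q : V} (hq : q ∈ Set.range f)
    (hqn : ∀ u, D.Touches q u → u ∈ Set.range f) {p s u : V} {b : Bool}
    (hp : p ∈ Set.range f) (hs : s ∈ Set.range f) (hps : D.dirAdj b p s)
    (hpu : D.dirAdj b p u) : u ∈ Set.range f := by
  by_contra hu
  have hps_ne : p ≠ s := by rintro rfl; exact hD.dirAdj_irrefl b _ hps
  have hqp : q ≠ p := by
    rintro rfl
    exact hu (hqn u (touches_iff_exists_dirAdj.2 ⟨b, hpu⟩))
  obtain ⟨c, hc⟩ := hD.exists_dicolouringOn {p}ᶜ (by simp)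
  obtain ⟨c', hc', -, hoff'⟩ := hf.exists_dicolouringOn hD hp hs hq hp hps_ne hqp hc
  obtain ⟨t, hqt, ht⟩ := hD.exists_dirAdj_colour_eq hc' b (c u)
  have hqt_ne : q ≠ t := by rintro rfl; exact hD.dirAdj_irrefl b _ hqt
  obtain ⟨c'', hc'', hs'', hoff''⟩ := hf.exists_dicolouringOn hD hq
    (hqn t (touches_iff_exists_dirAdj.2 ⟨b, hqt⟩)) hp hs hqt_ne hps_ne hc'
  have hsu : s = u := hD.injOn_dirAdj hc'' b hps hpu <| by
    rw [hs'', ht, hoff'' u hu, hoff' u hu]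
  exact hu (hsu ▸ hs)

/-- A cycle is spanning as soon as one of its vertices has all its neighbours on it. Otherwise,
the vertices of the cycle that have neighbours off the cycle are sources or sinks of the
subdigraph induced by the cycle. Dicolour the inside and the outside of the cycle separately, then
recolour these sources with `0` and these sinks with `1`: no monochromatic directed cycle can
enter the inside through a source and leave it through a sink. -/
theorem range_eq_univ (hD : D.IsCriticalRegular k) (hk : 2 ≤ k) {f : ℕ → V} {m : ℕ}
    (hf : D.IsPeriodicCycle f m) {q : V} (hq : q ∈ Set.range f)
    (hqn : ∀ u, D.Touches q u → u ∈ Set.range f) : Set.range f = Set.univ := by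
  classical
  by_contra hne
  have key := fun b p s u => hD.mem_range_of_dirAdj hf hq hqn (p := p) (s := s) (u := u) (b := b)
  have hnbr : ∀ p ∈ Set.range f, ∃ s ∈ Set.range f, D.Touches p s := by
    rintro _ ⟨i, rfl⟩
    exact ⟨_, ⟨i + 1, rfl⟩, hf.touches i⟩
  set C := Set.range f with hC
  obtain ⟨c₁, hc₁⟩ := hD.exists_dicolouringOn C hne
  obtain ⟨c₂, hc₂⟩ := hD.exists_dicolouringOn Cᶜ (by
    intro h
    exact (h ▸ Set.mem_univ q : q ∈ Cᶜ) hq)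
  let source : V → Prop := fun p => p ∈ C ∧ ∃ u ∉ C, D.Adj u p
  let sink : V → Prop := fun p => p ∈ C ∧ ∃ u ∉ C, D.Adj p u
  have hsource : ∀ p, source p → ∀ s ∈ C, ¬ D.Adj s p := fun p ⟨hp, u, hu, hup⟩ s hs hsp =>
    hu (key false p s u hp hs hsp hup)
  have hsink : ∀ p, sink p → ∀ s ∈ C, ¬ D.Adj p s := fun p ⟨hp, u, hu, hup⟩ s hs hsp =>
    hu (key true p s u hp hs hsp hup)
  have hdisj : ∀ p, source p → ¬ sink p := by
    intro p h1 h2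
    obtain ⟨s, hs, hps⟩ := hnbr p h1.1
    exact hps.elim (hsink p h2 s hs) (hsource p h1 s hs)
  let zero : Fin k := ⟨0, by omega⟩
  let one : Fin k := ⟨1, by omega⟩
  have h01 : zero ≠ one := by simp [zero, one]
  let c : V → Fin k := fun v =>
    if v ∈ C then (if source v then zero else if sink v then one else c₁ v) else c₂ v
  refine hD.not_dicolouringOn c fun i => ?_
  have hout : D.AcyclicOn (Cᶜ ∩ c ⁻¹' {i}) := by
    refine (hc₂ i).mono ?_
    rintro v ⟨hv, hvi⟩
    refine ⟨hv, ?_⟩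
    have hv' : v ∉ C := hv
    simpa [c, hv'] using hvi
  have hin : D.AcyclicOn (C ∩ c ⁻¹' {i}) := by
    have h1 : D.AcyclicOn {v | sink v} :=
      acyclicOn_of_forall_not_adj fun u hu v hv => hsink u hu v hv.1
    have h2 : D.AcyclicOn {v | source v} :=
      acyclicOn_of_forall_not_adj fun u hu v hv => hsource v hv u hu.1
    refine ((h1.union (hc₁ i) fun u hu v hv => hsink u hu v hv.1).union h2 ?_).mono ?_
    · rintro u (hu | hu) v hv
      · exact hsource v hv u hu.1
      · exact hsource v hv u hu.1
    · rintro v ⟨hv, hvi⟩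
      by_cases h1 : source v
      · exact Or.inr h1
      by_cases h2 : sink v
      · exact Or.inl (Or.inl h2)
      · refine Or.inl (Or.inr ⟨hv, ?_⟩)
        simpa [c, hv, h1, h2] using hvi
  by_cases hi : i = zero
  · refine (hin.union hout ?_).mono fun v hv => ?_
    · rintro u ⟨hu, hui⟩ v ⟨hv, -⟩ huv
      have h2 : sink u := ⟨hu, v, hv, huv⟩
      have h1 : ¬ source u := fun h1 => hdisj u h1 h2
      have : one = i := by simpa [c, hu, h1, h2] using hui
      exact h01 (hi.symm.trans this.symm)
    · by_cases hvC : v ∈ C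
      · exact Or.inl ⟨hvC, hv.2⟩
      · exact Or.inr ⟨hvC, hv.2⟩
  · refine (hout.union hin ?_).mono fun v hv => ?_
    · rintro u ⟨hu, -⟩ v ⟨hv, hvi⟩ huv
      have h1 : source v := ⟨hv, u, hu, huv⟩
      have : zero = i := by simpa [c, hv, h1] using hvi
      exact hi this.symm
    · by_cases hvC : v ∈ C
      · exact Or.inr ⟨hvC, hv.2⟩
      · exact Or.inl ⟨hvC, hv.2⟩

/-- Every path `y`, `x`, `z` of the underlying graph extends beyond `z` to a Hamiltonian path, listed
here from its end back to `y`. In a longest extension, the last vertex has all its neighbours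
on the path, hence on the cycle that it closes with the farthest of them. -/
theorem exists_hamiltonian_path (hD : D.IsCriticalRegular k) (hk : 2 ≤ k) {x y z : V}
    (hzx : D.Touches z x) (hxy : D.Touches x y) (hzy : z ≠ y) :
    ∃ t : List V, (t ++ [z, x, y]).Nodup ∧ (t ++ [z, x, y]).IsChain D.Touches ∧
      ∀ v, v ∈ t ++ [z, x, y] := by
  classical
  have := Fintype.ofFinite V
  let L : Set ℕ := {n | ∃ t : List V, t.length = n ∧ (t ++ [z, x, y]).Nodup ∧
    (t ++ [z, x, y]).IsChain D.Touches}
  have hne : L.Nonempty := ⟨0, [], rfl, by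
    simp [hzy, hD.ne_of_touches hzx, hD.ne_of_touches hxy], by simp [hzx, hxy]⟩
  have hbdd : BddAbove L := ⟨Fintype.card V, by
    rintro _ ⟨t, rfl, hnd, -⟩
    have := hnd.length_le_card
    simp only [List.length_append] at this
    omega⟩
  obtain ⟨t, hlen, hnd, hch⟩ := Nat.sSup_mem hne hbdd
  refine ⟨t, hnd, hch, ?_⟩
  have hmax : ∀ (h : 0 < (t ++ [z, x, y]).length) (u : V), D.Touches u (t ++ [z, x, y])[0] →
      u ∈ t ++ [z, x, y] := by
    intro _ u hu
    by_contra hmem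
    have : t.length + 1 ∈ L := by
      refine ⟨u :: t, rfl, List.nodup_cons.2 ⟨hmem, hnd⟩, List.IsChain.cons hch ?_⟩
      intro w hw
      rw [List.head?_eq_getElem?, List.getElem?_eq_getElem (by simp)] at hw
      obtain rfl : _ = w := by simpa using hw
      exact hu
    have := le_csSup hbdd this
    omega
  have hlen2 : 1 < (t ++ [z, x, y]).length := by simp
  generalize t ++ [z, x, y] = l at hnd hch hmax hlen2
  have hchain := List.isChain_iff_getElem.1 hch
  obtain ⟨j, hj, hjmax⟩ := Finset.exists_max_image
    (Finset.univ.filter fun j : Fin l.length => D.Touches l[j] l[0]) id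
    ⟨⟨1, hlen2⟩, by simpa using (hchain 0 hlen2).symm⟩
  simp only [Finset.mem_filter, Finset.mem_univ, true_and, id] at hj hjmax
  have hlt : ∀ i, i % (j.val + 1) < l.length := fun i =>
    (Nat.mod_lt i (Nat.succ_pos _)).trans_le j.2
  let f : ℕ → V := fun i => l[i % (j.val + 1)]'(hlt i)
  have hf : D.IsPeriodicCycle f (j.val + 1) := by
    refine ⟨Nat.succ_pos _, fun a b => hnd.getElem_inj_iff, fun i => ?_⟩
    have hi : i % (j.val + 1) < j.val + 1 := Nat.mod_lt i (Nat.succ_pos j.val)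
    by_cases hij : i % (j.val + 1) = j.val
    · have h1 : (i + 1) % (j.val + 1) = 0 := by
        rw [Nat.add_mod, hij]
        by_cases hj0 : j.val = 0
        · simp [hj0]
        · rw [Nat.mod_eq_of_lt (by omega : 1 < j.val + 1), Nat.mod_self]
      simpa only [f, h1, hij, Fin.getElem_fin] using hj
    · have h1 : (i + 1) % (j.val + 1) = i % (j.val + 1) + 1 := by
        rw [Nat.add_mod, Nat.mod_eq_of_lt (by omega : 1 < j.val + 1), Nat.mod_eq_of_lt (by omega)]
      simpa only [f, h1] using hchain (i % (j.val + 1)) (by omega)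
  have hmem : ∀ i : Fin l.length, i ≤ j → l[i] ∈ Set.range f := fun i hi =>
    ⟨i, by simp only [f, Nat.mod_eq_of_lt (Nat.lt_succ_of_le (show i.val ≤ j.val from hi))]; rfl⟩
  have huniv := hD.range_eq_univ hk hf (hmem ⟨0, by omega⟩ (Nat.zero_le _)) (by
    intro u hu
    obtain ⟨i, hi, rfl⟩ := List.mem_iff_getElem.1 (hmax _ u hu.symm)
    exact hmem ⟨i, hi⟩ (hjmax ⟨i, hi⟩ hu.symm))
  intro v
  obtain ⟨i, rfl⟩ : v ∈ Set.range f := huniv ▸ Set.mem_univ v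
  exact List.getElem_mem _

/-- Greedy colouring: a vertex with an uncoloured neighbour `u` can be coloured. -/
theorem exists_dicolouringOn_insert (hD : D.IsCriticalRegular k) {c : V → Fin k} {S : Set V}
    (hc : D.DicolouringOn c S) {v u : V} (hv : v ∉ S) (hu : u ∉ S) (hvu : D.Touches v u) :
    ∃ c' : V → Fin k, D.DicolouringOn c' (insert v S) ∧ ∀ w ∈ S, c' w = c w := by
  classical
  obtain ⟨b, hb⟩ := touches_iff_exists_dirAdj.1 hvu
  obtain ⟨i, hi⟩ : ∃ i, i ∉ c '' ({w | D.dirAdj b v w} ∩ S) := by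
    by_contra! hall
    have h1 : k ≤ ({w | D.dirAdj b v w} ∩ S).ncard := by
      have := Set.ncard_image_le (f := c) (Set.toFinite ({w | D.dirAdj b v w} ∩ S))
      rwa [Set.eq_univ_of_forall hall, Set.ncard_univ, Nat.card_eq_fintype_card,
        Fintype.card_fin] at this
    have h2 : ({w | D.dirAdj b v w} ∩ S).ncard < {w | D.dirAdj b v w}.ncard :=
      Set.ncard_lt_ncard ⟨Set.inter_subset_left, fun h => hu (h hb).2⟩
    rw [hD.ncard_dirAdj] at h2
    omega
  refine ⟨_, hc.update hD.loopless hv i b fun w hw hwi hvw => hi ⟨w, ⟨hvw, hw⟩, hwi⟩, ?_⟩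
  intro w hw
  exact Function.update_of_ne (fun (h : w = v) => hv (h ▸ hw)) _ _

/-- Greedy colouring along an uncoloured path, up to its last vertex. -/
theorem exists_dicolouringOn_path (hD : D.IsCriticalRegular k) {u : V} :
    ∀ (l : List V) {c : V → Fin k} {S : Set V}, D.DicolouringOn c S →
      (l ++ [u]).Nodup → (l ++ [u]).IsChain D.Touches → (∀ v ∈ l ++ [u], v ∉ S) →
      ∃ c' : V → Fin k, D.DicolouringOn c' (S ∪ {v | v ∈ l}) ∧ ∀ w ∈ S, c' w = c w
  | [], c, S, hc, _, _, _ => ⟨c, by simpa using hc, fun _ _ => rfl⟩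
  | v :: l, c, S, hc, hnd, hch, hS => by
    obtain ⟨w, hw, hvw⟩ : ∃ w ∈ l ++ [u], D.Touches v w := by
      cases l with
      | nil => exact ⟨u, by simp, by simpa using hch⟩
      | cons w l =>
        refine ⟨w, by simp, ?_⟩
        simp only [List.cons_append, List.isChain_cons_cons] at hch
        exact hch.1
    rw [List.cons_append, List.nodup_cons] at hnd
    obtain ⟨c₁, hc₁, hcc₁⟩ := hD.exists_dicolouringOn_insert hc (hS v (by simp))
      (hS w (List.mem_cons_of_mem _ hw)) hvw
    obtain ⟨c₂, hc₂, hcc₂⟩ := hD.exists_dicolouringOn_path l hc₁ hnd.2 hch.tail (by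
      rintro t ht (rfl | htS)
      · exact hnd.1 ht
      · exact hS t (List.mem_cons_of_mem _ ht) htS)
    refine ⟨c₂, hc₂.mono ?_, fun w hw => (hcc₂ w (Or.inr hw)).trans (hcc₁ w hw)⟩
    rintro t (ht | ht)
    · exact Or.inl (Or.inr ht)
    · rcases List.mem_cons.1 ht with rfl | ht
      · exact Or.inl (Or.inl rfl)
      · exact Or.inr ht

/-- If two out-neighbours `y`, `z` of `x` do not form a digon, then `x` has no further neighbours.
Indeed, extend the path `y`, `x`, `z` to a Hamiltonian path. If `x` had another neighbour `u` on
it, then one could give `y` and `z` the same colour and colour greedily, first from `z` up to the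
predecessor of `u`, then from the end of the path back to `u`; this leaves only `x` uncoloured. -/
theorem eq_or_eq_of_touches (hD : D.IsCriticalRegular k) (hk : 2 ≤ k) {x y z u : V}
    (hxy : D.Adj x y) (hxz : D.Adj x z) (hyz : y ≠ z) (hdigon : ¬ D.IsDigon y z)
    (hu : D.Touches x u) : u = y ∨ u = z := by
  by_contra! hne
  obtain ⟨t, hnd, hch, hall⟩ := hD.exists_hamiltonian_path hk (Or.inr hxz) (Or.inl hxy) hyz.symm
  have hxu := hD.ne_of_touches hu
  have hut : u ∈ t := by
    have := hall u
    simp only [List.mem_append, List.mem_cons, List.not_mem_nil, or_false] at this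
    rcases this with h | h | h | h
    · exact h
    · exact absurd h hne.2
    · exact absurd h.symm hxu
    · exact absurd h hne.1
  obtain ⟨t₁, t₂, rfl⟩ := List.append_of_mem hut
  let c₀ : V → Fin k := fun _ => ⟨0, by omega⟩
  have hc₀ : D.DicolouringOn c₀ {y, z} := by
    have hsingle : ∀ v, D.AcyclicOn {v} := fun v =>
      acyclicOn_of_forall_not_adj (by rintro _ rfl _ rfl; exact hD.loopless _)
    intro i
    refine AcyclicOn.mono ?_ Set.inter_subset_left
    by_cases h : D.Adj y z
    · have := (hsingle z).union (hsingle y) (by rintro _ rfl _ rfl h'; exact hdigon ⟨h, h'⟩)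
      rwa [Set.union_comm] at this
    · exact (hsingle y).union (hsingle z) (by rintro _ rfl _ rfl h'; exact h h')
  rw [List.append_assoc, List.cons_append] at hch hnd
  have hch₂ : (t₂.reverse ++ [u]).IsChain D.Touches := by
    rw [← List.reverse_cons, List.isChain_reverse]
    exact (hch.right_of_append.left_of_append (l₁ := u :: t₂)).imp fun _ _ h => h.symm
  have hch₁ : ((t₁ ++ [u]) ++ [x]).IsChain D.Touches := by
    have h : (t₁ ++ [u]).IsChain D.Touches := hch.prefix ⟨t₂ ++ [z, x, y], by simp⟩
    refine h.append (by simp) ?_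
    intro a ha b hb
    obtain rfl : u = a := by simpa using ha
    obtain rfl : x = b := by simpa using hb
    exact hu.symm
  simp only [List.nodup_append, List.nodup_cons, List.mem_append, List.mem_cons,
    List.not_mem_nil, or_false] at hnd
  clear hch
  have hnd₂ : (t₂.reverse ++ [u]).Nodup := by
    simp only [List.nodup_append, List.nodup_reverse, List.mem_reverse, List.mem_singleton]
    grind
  have hnd₁ : ((t₁ ++ [u]) ++ [x]).Nodup := by
    simp only [List.nodup_append, List.mem_append, List.mem_singleton]
    grind
  obtain ⟨c₁, hc₁, hcc₁⟩ := hD.exists_dicolouringOn_path t₂.reverse hc₀ hnd₂ hch₂ (by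
    simp only [List.mem_append, List.mem_reverse, List.mem_singleton, Set.mem_insert_iff,
      Set.mem_singleton_iff]
    grind)
  obtain ⟨c₂, hc₂, hcc₂⟩ := hD.exists_dicolouringOn_path (t₁ ++ [u]) hc₁ hnd₁ hch₁ (by
    simp only [List.mem_append, List.mem_reverse, List.mem_singleton, Set.mem_insert_iff,
      Set.mem_singleton_iff, Set.mem_union, Set.mem_ofPred_eq]
    clear hall hut hnd₁ hnd₂ hch₁ hch₂ hc₁ hcc₁
    rintro v ((hv | hv) | hv) ((hvS | hvS) | hvS) <;> grind)
  have hc : D.DicolouringOn c₂ {x}ᶜ := hc₂.mono fun v hv => by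
    have hvx : v ≠ x := hv
    have := hall v
    simp only [List.mem_append, List.mem_cons, List.not_mem_nil, or_false] at this
    simp only [List.mem_append, List.mem_reverse, List.mem_singleton, Set.mem_insert_iff,
      Set.mem_singleton_iff, Set.mem_union, Set.mem_ofPred_eq]
    tauto
  refine hyz (hD.injOn_dirAdj hc true hxy hxz ?_)
  rw [hcc₂ y (by simp), hcc₂ z (by simp), hcc₁ y (by simp), hcc₁ z (by simp)]

/-! ### Brooks' theorem for critical regular digraphs -/

theorem exists_clique_of_forall (hD : D.IsCriticalRegular k) (hk : 2 ≤ k) [Nonempty V]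
    (h : ∀ x y z, D.Adj x y → D.Adj x z → y ≠ z → D.IsDigon y z) :
    ∃ K : Set V, K.ncard = k + 1 ∧ K.Pairwise D.IsDigon := by
  obtain ⟨x⟩ := ‹Nonempty V›
  have hcard : {u | D.Adj x u}.ncard = k := hD.outDeg_eq x
  obtain ⟨y, hy⟩ : {u | D.Adj x u}.Nonempty := Set.nonempty_of_ncard_ne_zero (by omega)
  -- The out-neighbourhood of `y` contains that of `x` but for `y` itself, hence one more vertex.
  obtain ⟨p, hyp, hxp⟩ : ∃ p, D.Adj y p ∧ ¬ D.Adj x p := by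
    by_contra! hno
    have hlt : {u | D.Adj y u}.ncard < {u | D.Adj x u}.ncard :=
      Set.ncard_lt_ncard ⟨hno, fun hle => hD.loopless y (hle hy)⟩
    rw [hcard] at hlt
    exact hlt.ne (hD.outDeg_eq y)
  have hne : ∀ z, D.Adj x z → z ≠ p := fun z hz hzp => hxp (hzp ▸ hz)
  have h1 : ∀ z, D.Adj x z → z ≠ y → D.IsDigon z p := fun z hz hzy =>
    h y z p (h x y z hy hz hzy.symm).1 hyp (hne z hz)
  have h2 : D.IsDigon y p := by
    obtain ⟨z, hz, hzy⟩ := Set.exists_ne_of_one_lt_ncard (by omega : 1 < {u | D.Adj x u}.ncard) y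
    exact h z y p (h x z y hz hy hzy).1 (h1 z hz hzy).1 (hne y hy)
  have h3 : ∀ z, D.Adj x z → D.IsDigon z p := fun z hz => by
    by_cases hzy : z = y
    · exact hzy ▸ h2
    · exact h1 z hz hzy
  refine ⟨insert p {u | D.Adj x u}, ?_, ?_⟩
  · rw [Set.ncard_insert_of_notMem (s := {u | D.Adj x u}) hxp, hcard]
  · rintro u (rfl | hu) v (rfl | hv) huv
    · exact absurd rfl huv
    · exact (h3 v hv).symm
    · exact h3 u hu
    · exact h x u v hu hv huv

/-- Brooks' theorem for digraphs, in a form sufficient here: a critical `k`-diregular digraph with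
`k ≥ 2` contains a complete bidirected subdigraph on `k + 1` vertices, unless `k = 2` and all its
arcs lie in digons. (In the exceptional case it is a bidirected odd cycle.) -/
theorem exists_clique_or (hD : D.IsCriticalRegular k) (hk : 2 ≤ k) [Nonempty V] :
    (∃ K : Set V, K.ncard = k + 1 ∧ K.Pairwise D.IsDigon) ∨
      (k = 2 ∧ ∀ u v, D.Adj u v → D.Adj v u) := by
  by_cases hall : ∀ x y z, D.Adj x y → D.Adj x z → y ≠ z → D.IsDigon y z
  · exact Or.inl (hD.exists_clique_of_forall hk hall)
  have hnbr : ∀ x y z, D.Adj x y → D.Adj x z → y ≠ z → ¬ D.IsDigon y z →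
      {u | D.Touches x u} ⊆ {y, z} := fun x y z hy hz hyz hd u hu =>
    hD.eq_or_eq_of_touches hk hy hz hyz hd hu
  have hk2 : k = 2 := by
    push Not at hall
    obtain ⟨x, y, z, hy, hz, hyz, hd⟩ := hall
    have h1 : {u | D.Adj x u}.ncard ≤ ({y, z} : Set V).ncard :=
      Set.ncard_le_ncard fun u hu => hnbr x y z hy hz hyz hd (Or.inl hu)
    rw [Set.ncard_pair hyz] at h1
    have : {u | D.Adj x u}.ncard = k := hD.outDeg_eq x
    omega
  have hsymm : ∀ x y z, D.Adj x y → D.Adj x z → y ≠ z → ¬ D.IsDigon y z →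
      ∀ u, D.Touches x u → D.IsDigon x u := by
    intro x y z hy hz hyz hd u hu
    have hsub := hnbr x y z hy hz hyz hd
    have h2 : {u | D.Adj u x} = {y, z} := by
      refine Set.eq_of_subset_of_ncard_le (fun u hu => hsub (Or.inr hu)) ?_
      rw [Set.ncard_pair hyz]
      exact hk2.symm.le.trans (hD.inDeg_eq x).symm.le
    have hmem := hsub hu
    refine ⟨?_, h2.symm.subset hmem⟩
    rcases hmem with rfl | rfl
    · exact hy
    · exact hz
  by_cases harcs : ∀ u v, D.Adj u v → D.Adj v u
  · exact Or.inr ⟨hk2, harcs⟩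
  refine Or.inl ?_
  push Not at harcs
  -- Both ends of an arc `x → z` outside all digons have bidirected out-neighbourhoods.
  obtain ⟨x, z, hxz, hzx⟩ := harcs
  have hx : ∀ u v, D.Adj x u → D.Adj x v → u ≠ v → D.IsDigon u v := fun u v hu hv huv => by
    by_contra hd
    exact hzx (hsymm x u v hu hv huv hd z (Or.inl hxz)).2
  have hz : ∀ u v, D.Adj z u → D.Adj z v → u ≠ v → D.IsDigon u v := fun u v hu hv huv => by
    by_contra hd
    exact hzx (hsymm z u v hu hv huv hd x (Or.inr hxz)).1
  have hxcard : {u | D.Adj x u}.ncard = k := hD.outDeg_eq x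
  have hzcard : {u | D.Adj z u}.ncard = k := hD.outDeg_eq z
  obtain ⟨y, hxy, hyz⟩ := Set.exists_ne_of_one_lt_ncard
    (by omega : 1 < {u | D.Adj x u}.ncard) z
  have hdyz := hx y z hxy hxz hyz
  obtain ⟨p, hzp, hpy⟩ := Set.exists_ne_of_one_lt_ncard
    (by omega : 1 < {u | D.Adj z u}.ncard) y
  have hdyp := hz y p hdyz.2 hzp hpy.symm
  have hpz : p ≠ z := by rintro rfl; exact hD.loopless _ hzp
  have hpx : p ≠ x := by rintro rfl; exact hzx hzp
  have hxz_ne := hD.ne_of_touches (Or.inl hxz)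
  have hdzp : D.IsDigon z p := by
    by_contra hd
    -- Otherwise `y` would be joined by digons to the three vertices `x`, `z` and `p`.
    rcases hnbr y z p hdyz.1 hdyp.1 hpz.symm hd (Or.inr hxy : D.Touches y x) with h | h
    · exact hxz_ne h
    · exact hpx h.symm
  refine ⟨{y, z, p}, ?_, ?_⟩
  · rw [hk2, Set.ncard_eq_three]
    exact ⟨y, z, p, hyz, hpy.symm, hpz.symm, rfl⟩
  · rintro u (rfl | rfl | rfl) v (rfl | rfl | rfl) huv
    all_goals first
      | exact absurd rfl huv
      | assumption
      | exact IsDigon.symm ‹_›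

end IsCriticalRegular

/-! ### Making a digraph regular -/

section DoubleCut

variable {V : Type*} {D : Digraph V}

/-- Every arc from `X` to its complement is made a digon, every arc in the other direction is
removed, and the arcs inside `X` and inside its complement are kept. -/
def doubleCut (D : Digraph V) (X : Set V) : Digraph V where
  Adj u v := (u ∈ X ∨ v ∉ X) ∧ D.Adj u v ∨ (u ∉ X ∧ v ∈ X) ∧ D.Adj v u

variable {X : Set V}

theorem doubleCut_adj_of_mem {u v : V} (hu : u ∈ X) : (D.doubleCut X).Adj u v ↔ D.Adj u v := by
  simp [doubleCut, hu]

theorem doubleCut_adj_of_notMem {u v : V} (hv : v ∉ X) : (D.doubleCut X).Adj u v ↔ D.Adj u v := by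
  simp [doubleCut, hv]

theorem doubleCut_adj_of_iff {u v : V} (huv : u ∈ X ↔ v ∈ X) :
    (D.doubleCut X).Adj u v ↔ D.Adj u v := by
  by_cases hv : v ∈ X <;> simp [doubleCut, hv, huv]

theorem doubleCut_adj_comm {u v : V} (hu : u ∈ X) (hv : v ∉ X) :
    (D.doubleCut X).Adj u v ↔ (D.doubleCut X).Adj v u := by
  simp [doubleCut, hu, hv]

theorem isDigon_of_doubleCut {u v : V} (huv : u ∈ X ↔ v ∈ X) (h : (D.doubleCut X).IsDigon u v) :
    D.IsDigon u v :=
  ⟨(doubleCut_adj_of_iff huv).1 h.1, (doubleCut_adj_of_iff huv.symm).1 h.2⟩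

theorem AcyclicOn.of_adj_imp {D' : Digraph V} {S : Set V} (h : D'.AcyclicOn S)
    (himp : ∀ u ∈ S, ∀ v ∈ S, D.Adj u v → D'.Adj u v) : D.AcyclicOn S := by
  intro T hT hne
  obtain ⟨v, hv, hsink⟩ := h T hT hne
  exact ⟨v, hv, fun w hw hvw => hsink w hw (himp v (hT hv) w (hT hw) hvw)⟩

/-- In a colour class of `D.doubleCut X` no arc of `D` leads from `X` to its complement, so a
directed cycle of `D` in this class would lie inside `X` or inside its complement. -/
theorem DicolouringOn.of_doubleCut {k : ℕ} {c : V → Fin k} {S : Set V}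
    (h : (D.doubleCut X).DicolouringOn c S) : D.DicolouringOn c S := by
  intro i
  set T := S ∩ c ⁻¹' {i}
  have hin : D.AcyclicOn (T ∩ X) := ((h i).mono Set.inter_subset_left).of_adj_imp
    fun u hu v hv huv => (doubleCut_adj_of_mem hu.2).2 huv
  have hout : D.AcyclicOn (T \ X) := ((h i).mono Set.sdiff_subset).of_adj_imp
    fun u hu v hv huv => (doubleCut_adj_of_notMem hv.2).2 huv
  have := hin.union hout fun u hu v hv huv => by
    have huv' := (doubleCut_adj_of_mem hu.2).2 huv
    exact (h i).not_isDigon hu.1 hv.1 ⟨huv', (doubleCut_adj_comm hu.2 hv.2).1 huv'⟩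
  rwa [Set.inter_union_sdiff] at this

end DoubleCut

section Regular

theorem acyclicOn_induce_iff {V : Type*} {D : Digraph V} {W : Set V} {S : Set W} :
    (D.induce W).AcyclicOn S ↔ D.AcyclicOn (Subtype.val '' S) := by
  constructor
  · intro h T hT hne
    obtain ⟨T, rfl⟩ : ∃ T' : Set W, T = Subtype.val '' T' :=
      ⟨Subtype.val ⁻¹' T, by
        rw [Subtype.image_preimage_coe, Set.inter_eq_right.2]
        exact hT.trans (Subtype.coe_image_subset _ _)⟩
    obtain ⟨v, hv, hsink⟩ := h T ((Set.image_subset_image_iff Subtype.val_injective).1 hT)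
      hne.of_image
    exact ⟨v, ⟨v, hv, rfl⟩, by rintro _ ⟨w, hw, rfl⟩; exact hsink w hw⟩
  · intro h T hT hne
    obtain ⟨_, ⟨v, hv, rfl⟩, hsink⟩ := h _ (Set.image_mono hT) (hne.image _)
    exact ⟨v, hv, fun w hw => hsink w ⟨w, hw, rfl⟩⟩

variable {V : Type*} [Finite V] {D : Digraph V} {k : ℕ}

/-- The arcs inside `X` contribute equally to both sums; the arcs at the boundary of `X` lie in
digons. -/
theorem sum_outDeg_eq_sum_inDeg (X : Finset V)
    (hX : ∀ u ∈ X, ∀ v ∉ X, D.Adj u v ↔ D.Adj v u) :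
    ∑ v ∈ X, D.outDeg v = ∑ v ∈ X, D.inDeg v := by
  classical
  have := Fintype.ofFinite V
  have hout : ∀ v, D.outDeg v =
      ∑ w ∈ X, (if D.Adj v w then 1 else 0) + ∑ w ∈ Xᶜ, (if D.Adj v w then 1 else 0) := by
    intro v
    rw [Finset.sum_add_sum_compl, outDeg, Set.ncard_eq_toFinset_card', Finset.sum_boole]
    simp
  have hin : ∀ v, D.inDeg v =
      ∑ w ∈ X, (if D.Adj w v then 1 else 0) + ∑ w ∈ Xᶜ, (if D.Adj w v then 1 else 0) := by
    intro v
    rw [Finset.sum_add_sum_compl, inDeg, Set.ncard_eq_toFinset_card', Finset.sum_boole]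
    simp
  simp only [hout, hin, Finset.sum_add_distrib]
  congr 1
  · exact Finset.sum_comm
  · refine Finset.sum_congr rfl fun v hv => Finset.sum_congr rfl fun w hw => ?_
    simp only [hX v hv w (Finset.mem_compl.1 hw)]

/-- If only digons join `X` to its complement, bounding the out-degrees in `X` and the in-degrees
off `X` suffices for a critical digraph to be regular. -/
theorem IsCritical.isCriticalRegular {X : Set V} (hD : D.IsCritical k)
    (hX : ∀ u ∈ X, ∀ v ∉ X, D.Adj u v ↔ D.Adj v u) (hout : ∀ v ∈ X, D.outDeg v ≤ k)
    (hin : ∀ v ∉ X, D.inDeg v ≤ k) : D.IsCriticalRegular k := by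
  classical
  have := Fintype.ofFinite V
  have hkout : ∀ v, k ≤ D.outDeg v := hD.le_ncard_dirAdj true
  have hkin : ∀ v, k ≤ D.inDeg v := hD.le_ncard_dirAdj false
  have hout' : ∀ v ∈ X, D.outDeg v = k := fun v hv => (hout v hv).antisymm (hkout v)
  have hin' : ∀ v ∉ X, D.inDeg v = k := fun v hv => (hin v hv).antisymm (hkin v)
  have h1 := sum_outDeg_eq_sum_inDeg (D := D) X.toFinset (by simpa using hX)
  have h2 := sum_outDeg_eq_sum_inDeg (D := D) X.toFinsetᶜ (by
    simpa using fun u hu v hv => (hX v hv u hu).symm)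
  rw [Finset.sum_congr rfl fun v hv => hout' v (by simpa using hv),
    Finset.sum_eq_sum_iff_of_le fun v _ => hkin v] at h1
  rw [eq_comm, Finset.sum_congr rfl fun v hv => hin' v (by simpa using hv),
    Finset.sum_eq_sum_iff_of_le fun v _ => hkout v] at h2
  refine ⟨hD, fun v => ?_, fun v => ?_⟩
  · by_cases hv : v ∈ X
    · exact hout' v hv
    · exact (h2 v (by simpa using hv)).symm
  · by_cases hv : v ∈ X
    · exact (h1 v (by simpa using hv)).symm
    · exact hin' v hv

/-- A minimal vertex set without a `k`-dicolouring induces a critical subdigraph. -/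
theorem exists_isCritical_induce (hloop : ∀ v, ¬ D.Adj v v) (hk : 0 < k)
    (hD : ∀ c : V → Fin k, ¬ D.DicolouringOn c Set.univ) :
    ∃ W : Set V, W.Nonempty ∧ (D.induce W).IsCritical k := by
  classical
  obtain ⟨W, hW, hmin⟩ := wellFounded_lt.has_min
    {W : Set V | ∀ c : V → Fin k, ¬ D.DicolouringOn c W} ⟨Set.univ, hD⟩
  refine ⟨W, ?_, fun v => hloop v, fun c hc => ?_, fun S hS => ?_⟩
  · rw [Set.nonempty_iff_ne_empty]
    rintro rfl
    refine hW (fun _ => ⟨0, hk⟩) fun i => ?_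
    exact acyclicOn_of_forall_not_adj fun u hu => hu.1.elim
  · refine hW (fun v => if hv : v ∈ W then c ⟨v, hv⟩ else ⟨0, hk⟩) fun i => ?_
    refine (acyclicOn_induce_iff.1 (hc i)).mono ?_
    rintro v ⟨hv, hvi⟩
    exact ⟨⟨v, hv⟩, ⟨trivial, by simpa [hv] using hvi⟩, rfl⟩
  · have hlt : Subtype.val '' S < W := by
      refine ⟨Subtype.coe_image_subset _ _, fun hle => hS ?_⟩
      refine Set.eq_univ_of_forall fun v => ?_
      obtain ⟨w, hw, hwv⟩ := hle v.2
      rwa [← Subtype.ext hwv]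
    obtain ⟨c, hc⟩ : ∃ c : V → Fin k, D.DicolouringOn c (Subtype.val '' S) := by
      by_contra! hno
      exact hmin _ hno hlt
    refine ⟨fun v => c v, fun i => acyclicOn_induce_iff.2 ((hc i).mono ?_)⟩
    rintro _ ⟨v, ⟨hv, hvi⟩, rfl⟩
    exact ⟨⟨v, hv, rfl⟩, hvi⟩

theorem outDeg_induce_le (W : Set V) (v : W) : (D.induce W).outDeg v ≤ D.outDeg v := by
  rw [outDeg, ← Set.ncard_image_of_injective _ Subtype.val_injective]
  refine Set.ncard_le_ncard ?_
  rintro _ ⟨w, hw, rfl⟩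
  exact hw

theorem inDeg_induce_le (W : Set V) (v : W) : (D.induce W).inDeg v ≤ D.inDeg v := by
  rw [inDeg, ← Set.ncard_image_of_injective _ Subtype.val_injective]
  refine Set.ncard_le_ncard ?_
  rintro _ ⟨w, hw, rfl⟩
  exact hw

end Regular

/-! ### Large bidirected cliques -/

section Clique

variable {V : Type*} [Finite V] {D : Digraph V} {k : ℕ}

theorem containsSubdigraph_of_pairwise_isDigon {S : Set V} (hS : S.Pairwise D.IsDigon) {n : ℕ}
    (hn : n ≤ S.ncard) :
    D.ContainsSubdigraph (bidirected (SimpleGraph.completeGraph (Fin n))) := by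
  classical
  have := Fintype.ofFinite S
  obtain ⟨f⟩ : Nonempty (Fin n ↪ S) := Function.Embedding.nonempty_of_card_le <| by
    rwa [Fintype.card_fin, ← Nat.card_eq_fintype_card]
  refine ⟨fun i => f i, Subtype.val_injective.comp f.injective, fun a b hab => ?_⟩
  have hne : a ≠ b := hab
  exact (hS (f a).2 (f b).2 fun h => hne (f.injective (Subtype.ext h))).1

/-- If every vertex has out-degree or in-degree at most `k` and `D` is not `k`-dicolourable, then
`D` has a bidirected clique on at least half of `k + 1` vertices: for the set `X` of vertices of
out-degree at most `k`, the digraph `D.doubleCut X` contains a bidirected clique on `k + 1`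
vertices, whose parts in `X` and off `X` are bidirected cliques of `D`. -/
theorem exists_pairwise_isDigon (hloop : ∀ v, ¬ D.Adj v v) (hk : 2 ≤ k)
    (hdeg : ∀ v, D.outDeg v ≤ k ∨ D.inDeg v ≤ k)
    (hD : ∀ c : V → Fin k, ¬ D.DicolouringOn c Set.univ) :
    ∃ S : Set V, S.Pairwise D.IsDigon ∧ k + 1 ≤ 2 * S.ncard := by
  classical
  let X : Set V := {v | D.outDeg v ≤ k}
  obtain ⟨W, hWne, hW⟩ := exists_isCritical_induce (D := D.doubleCut X)
    (fun v => by rw [doubleCut_adj_of_iff Iff.rfl]; exact hloop v) (by omega)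
    (fun c hc => hD c hc.of_doubleCut)
  have := hWne.to_subtype
  have hreg : ((D.doubleCut X).induce W).IsCriticalRegular k := by
    refine hW.isCriticalRegular (X := Subtype.val ⁻¹' X)
      (fun u hu v hv => doubleCut_adj_comm (D := D) (X := X) hu hv) (fun v hv => ?_) (fun v hv => ?_)
    · refine (outDeg_induce_le W v).trans ?_
      have : (D.doubleCut X).outDeg v = D.outDeg v := by
        simp only [outDeg, doubleCut_adj_of_mem (show (v : V) ∈ X from hv)]
      exact this.trans_le hv
    · refine (inDeg_induce_le W v).trans ?_
      have : (D.doubleCut X).inDeg v = D.inDeg v := by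
        simp only [inDeg, doubleCut_adj_of_notMem (show (v : V) ∉ X from hv)]
      exact this.trans_le ((hdeg v).resolve_left hv)
  rcases hreg.exists_clique_or hk with ⟨K, hcard, hK⟩ | ⟨rfl, hsymm⟩
  · have hK' : (Subtype.val '' K).Pairwise (D.doubleCut X).IsDigon := by
      rintro _ ⟨u, hu, rfl⟩ _ ⟨v, hv, rfl⟩ huv
      exact hK hu hv fun h => huv (congrArg _ h)
    rw [← Set.ncard_image_of_injective _ Subtype.val_injective] at hcard
    have hsum := Set.ncard_inter_add_ncard_sdiff_eq_ncard (Subtype.val '' K) X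
    rcases le_total (Subtype.val '' K \ X).ncard (Subtype.val '' K ∩ X).ncard with hle | hle
    · refine ⟨Subtype.val '' K ∩ X, fun u hu v hv huv => ?_, by omega⟩
      exact isDigon_of_doubleCut (by simp only [hu.2, hv.2]) (hK' hu.1 hv.1 huv)
    · refine ⟨Subtype.val '' K \ X, fun u hu v hv huv => ?_, by omega⟩
      exact isDigon_of_doubleCut (by simp only [hu.2, hv.2]) (hK' hu.1 hv.1 huv)
  · -- All arcs lie in digons. They cannot all join `X` to its complement, as otherwise this
    -- partition would be a dicolouring with two colours.
    obtain ⟨u, v, huv, hside⟩ : ∃ u v : W, ((D.doubleCut X).induce W).Adj u v ∧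
        ((u : V) ∈ X ↔ (v : V) ∈ X) := by
      by_contra! hno
      refine hreg.not_dicolouringOn (fun v => if (v : V) ∈ X then 0 else 1) fun i => ?_
      refine acyclicOn_of_forall_not_adj fun u hu v hv huv => ?_
      have h : (if (u : V) ∈ X then (0 : Fin 2) else 1) = if (v : V) ∈ X then 0 else 1 :=
        hu.2.trans hv.2.symm
      have := hno u v huv
      clear hu hv
      by_cases h1 : (u : V) ∈ X <;> by_cases h2 : (v : V) ∈ X <;> simp [h1, h2] at h this
    have hd := isDigon_of_doubleCut hside ⟨huv, hsymm u v huv⟩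
    have hne : (u : V) ≠ v := by
      intro h
      have := hd.1
      rw [h] at this
      exact hloop _ this
    refine ⟨{(u : V), (v : V)}, ?_, by rw [Set.ncard_pair hne]; omega⟩
    rintro a (rfl | rfl) b (rfl | rfl) hab
    exacts [absurd rfl hab, hd, hd.symm, absurd rfl hab]

end Clique

end Digraph

theorem corollary7 {V : Type*} [Fintype V] (D : Digraph V) (hloopless : ∀ v : V, ¬ D.Adj v v)
    (h : D.dichromaticNumber = D.deltaMin + 1) :
    D.ContainsSubdigraph
      (Digraph.bidirected (SimpleGraph.completeGraph (Fin ⌈((D.deltaMin : ℚ) + 1) / 2⌉₊))) := by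
  set k := D.deltaMin with hk
  have hcol : ∀ c : V → Fin k, ¬ D.DicolouringOn c Set.univ := fun c hc => by
    have : D.dichromaticNumber ≤ k := Nat.sInf_le ⟨c, Digraph.isDicolouring_of_dicolouringOn hc⟩
    omega
  have hdeg : ∀ v, D.outDeg v ≤ k ∨ D.inDeg v ≤ k := fun v =>
    min_le_iff.1 (Finset.le_sup (f := D.vertexMinDeg) (Finset.mem_univ v))
  obtain ⟨S, hS, hcard⟩ : ∃ S : Set V, S.Pairwise D.IsDigon ∧ k + 1 ≤ 2 * S.ncard := by
    by_cases hk2 : 2 ≤ k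
    · exact Digraph.exists_pairwise_isDigon hloopless hk2 hdeg hcol
    · -- One vertex suffices, and `D` has one since otherwise no colour would be needed.
      obtain ⟨v⟩ : Nonempty V := by
        by_contra hV
        rw [not_nonempty_iff] at hV
        exact hcol hV.elim fun i => Digraph.acyclicOn_of_forall_not_adj fun u => hV.elim u
      exact ⟨{v}, Set.pairwise_singleton _ _, by rw [Set.ncard_singleton]; omega⟩
  refine Digraph.containsSubdigraph_of_pairwise_isDigon hS ?_
  rw [Nat.ceil_le, div_le_iff₀ two_pos]
  have : ((k + 1 : ℕ) : ℚ) ≤ ((2 * S.ncard : ℕ) : ℚ) := by exact_mod_cast hcard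
  push_cast at this
  linarith
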